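/- For a real $m\times n$ matrix $A$ let $$\gamma_2(A)=\min\{\|B\|_{2\to\infty}\,\|C\|_{1\to 2} : A=BC\},$$ where $B$ and $C$ range over the real $m\times k$ and $k\times n$ matrices, for all $k$, and $\|\cdot\|_{p\to q}$ is the operator norm from $\ell_p$ to $\ell_q$. Let $$\operatorname{detlb}A=\max_{k\ge 1}\max_B|\det B|^{1/k},$$ where $B$ ranges over all $k\times k$ submatrices of $A$ ($\operatorname{detlb}A=0$ if $A$ has no rows or no columns), and let $$\operatorname{herdisc}A=\max_{J\subseteq[n]}\ \min_{x\in\{-1,1\}^J}\|A_Jx\|_\infty,$$ where $A_J$ is the submatrix of $A$ consisting of the columns indexed by $J$. Theorem. There is an absolute constant $C>0$ such that for all $m,n$ and every real $m\times n$ matrix $A$ of rank $r$, $$\operatorname{detlb}A\ \le\ \gamma_2(A)\ \le\ C\log(r+1)\cdot\operatorname{detlb}A .$$ Moreover, $\operatorname{herdisc}A\ge\frac12\operatorname{detlb}A$, and consequently $$\gamma_2(A)\ \le\ C\log(\min\{m,n\}+1)\cdot\operatorname{herdisc}A\ \le\ C\log(m+1)\cdot\operatorname{herdisc}A .$$ 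-/

import Mathlib

noncomputable section

open scoped ENNReal

namespace FactorizationNorm

/-- The operator norm `‖M‖_{p → q}` of a real matrix `M`, viewed as a linear map
`x ↦ M x` from `ℓ_p^n` to `ℓ_q^m`. -/
def opNorm (p q : ℝ≥0∞) [Fact (1 ≤ p)] [Fact (1 ≤ q)] {m n : ℕ}
    (M : Matrix (Fin m) (Fin n) ℝ) : ℝ :=
  ‖LinearMap.toContinuousLinearMap (Matrix.toLpLin p q M)‖

/-- The factorization norm
`γ₂(A) = min {‖B‖_{2 → ∞} ‖C‖_{1 → 2} : A = B C}`, where the factorization is through the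
Euclidean space `ℓ₂^k` of an arbitrary finite dimension `k`. -/
def gammaTwo {m n : ℕ} (A : Matrix (Fin m) (Fin n) ℝ) : ℝ :=
  sInf {c : ℝ | ∃ (k : ℕ) (B : Matrix (Fin m) (Fin k) ℝ) (C : Matrix (Fin k) (Fin n) ℝ),
    A = B * C ∧ c = opNorm 2 ∞ B * opNorm 1 2 C}

/-- The determinant lower bound `detlb A`: the maximum of `|det B|^{1/k}` over all `k ≥ 1` and all
`k × k` submatrices `B` of `A`. The set is finite; it is empty, and `detlb A = 0`, only if `A` has
no rows or no columns. -/
def detlb {m n : ℕ} (A : Matrix (Fin m) (Fin n) ℝ) : ℝ :=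
  sSup {d : ℝ | ∃ k : ℕ, 1 ≤ k ∧ ∃ (f : Fin k ↪o Fin m) (g : Fin k ↪o Fin n),
    d = |(A.submatrix f g).det| ^ (1 / (k : ℝ))}

/-- The discrepancy `disc A = min {‖A x‖_∞ : x ∈ {-1, 1}^ι}` of a matrix with columns indexed by
`ι`. The norm on `Fin m → ℝ` is the maximum norm. -/
def disc {m : ℕ} {ι : Type*} [Fintype ι] (A : Matrix (Fin m) ι ℝ) : ℝ :=
  sInf {d : ℝ | ∃ x : ι → ℝ, (∀ j, x j = 1 ∨ x j = -1) ∧ d = ‖A.mulVec x‖}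

/-- The hereditary discrepancy `herdisc A`: the maximum of `disc A_J` over all sets `J` of columns,
where `A_J` is the submatrix of `A` consisting of the columns in `J`. -/
def herdisc {m n : ℕ} (A : Matrix (Fin m) (Fin n) ℝ) : ℝ :=
  sSup {d : ℝ | ∃ J : Finset (Fin n), d = disc (A.submatrix id (fun j : J => (j : Fin n)))}

end FactorizationNorm

end

open scoped ENNReal

namespace FactorizationNorm

open Matrix Finset

/-! The lower bound: a minor of `B * C` is the determinant of some rows of `B` times some columns of
`C`, so Cauchy–Binet, Cauchy–Schwarz and Hadamard bound it by `(‖B‖ ‖C‖) ^ k` (`abs_det_mul_le`).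

The upper bound: by Hahn–Banach (`gammaTwo_le_of_forall_weighted`) it is enough to bound a weighted
sum of squared row and column norms, separately for each choice of weights `p`, `q`. Splitting the
singular value decomposition of `M = diag(√p) A diag(√q)` evenly makes this sum twice the sum of the
singular values. By Cauchy–Binet, the product of any `k` singular values is at most `c ^ k / k!`,
with `c` proportional to `detlb A` (`prod_le_of_orthogonal_diagonalization`). Hence the `j`-th
largest is at most `e c / j`, and the sum over the rank many nonzero ones is harmonic.

The discrepancy bound: colouring the odd digits rounds every real vector to an integer one with
error at most `H = herdisc A`. For a nonsingular square submatrix `B`, integer translates of slight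
enlargements of `{x : ‖B x‖ ≤ H}` therefore cover space, so its volume `(2 H) ^ k / |det B|` is at
least 1. -/

/-! ### Determinant inequalities for products of rectangular matrices. -/

/-- Expansion of the determinant of a product of rectangular matrices along the rows of the
first factor. -/
theorem det_mul_eq_sum_prod {k : ℕ} {ι : Type*} [Fintype ι] [DecidableEq ι]
    (A : Matrix (Fin k) ι ℝ) (B : Matrix ι (Fin k) ℝ) :
    (A * B).det = ∑ f : Fin k → ι, (∏ i, A i (f i)) * (B.submatrix f id).det := by
  have h : A * B = Matrix.of fun i => ∑ l, A i l • B l := by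
    ext i j
    simp [Matrix.mul_apply]
  have h2 := (Matrix.detRowAlternating (n := Fin k) (R := ℝ)).toMultilinearMap.map_sum
    (fun (i : Fin k) (l : ι) => A i l • B l)
  rw [h]
  refine Eq.trans h2 (Finset.sum_congr rfl fun f _ => ?_)
  exact (Matrix.detRowAlternating (n := Fin k) (R := ℝ)).toMultilinearMap.map_smul_univ
    (fun i => A i (f i)) (fun i => B (f i))

/-- The Cauchy–Binet formula, with the sum taken over all functions instead of over all
`k`-element subsets. -/
theorem factorial_mul_det_mul {k : ℕ} {ι : Type*} [Fintype ι] [DecidableEq ι]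
    (A : Matrix (Fin k) ι ℝ) (B : Matrix ι (Fin k) ℝ) :
    (k.factorial : ℝ) * (A * B).det =
      ∑ f : Fin k → ι, (A.submatrix id f).det * (B.submatrix f id).det := by
  -- Reindexing by `f ∘ σ` permutes the rows of `B` and produces the sign; summing over `σ` then
  -- assembles the determinant of the columns of `A`.
  have h (σ : Equiv.Perm (Fin k)) : (A * B).det =
      ∑ f : Fin k → ι, ((Equiv.Perm.sign σ : ℤ) : ℝ) * (∏ i, A i (f (σ i))) *
        (B.submatrix f id).det := by
    rw [det_mul_eq_sum_prod, ← (Equiv.arrowCongr σ.symm (Equiv.refl ι)).sum_comp]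
    refine Finset.sum_congr rfl fun f _ => ?_
    have h3 : (B.submatrix ((Equiv.arrowCongr σ.symm (Equiv.refl ι)) f) id).det =
      ((Equiv.Perm.sign σ : ℤ) : ℝ) * (B.submatrix f id).det :=
      Matrix.det_permute σ (B.submatrix f id)
    rw [h3]
    simp only [Equiv.arrowCongr_apply, Function.comp_apply, Equiv.symm_symm, Equiv.coe_refl, id]
    ring
  have hs : ∑ _σ : Equiv.Perm (Fin k), (A * B).det = (k.factorial : ℝ) * (A * B).det := by
    simp [Fintype.card_perm]
  rw [← hs, Finset.sum_congr rfl fun σ _ => h σ, Finset.sum_comm]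
  refine Finset.sum_congr rfl fun f _ => ?_
  rw [← Finset.sum_mul, ← Matrix.det_transpose (A.submatrix id f),
    Matrix.det_apply' (A.submatrix id f)ᵀ]
  rfl

theorem factorial_mul_det_transpose_mul_self {k : ℕ} {ι : Type*} [Fintype ι] [DecidableEq ι]
    (X : Matrix ι (Fin k) ℝ) :
    (k.factorial : ℝ) * (Xᵀ * X).det = ∑ f : Fin k → ι, (X.submatrix f id).det ^ 2 := by
  rw [factorial_mul_det_mul]
  refine Finset.sum_congr rfl fun f _ => ?_
  rw [sq]
  congr 1
  rw [← Matrix.det_transpose]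
  rfl

theorem det_transpose_mul_self_nonneg {k : ℕ} {ι : Type*} [Fintype ι] [DecidableEq ι]
    (X : Matrix ι (Fin k) ℝ) : 0 ≤ (Xᵀ * X).det := by
  have h := factorial_mul_det_transpose_mul_self X
  have : 0 ≤ (k.factorial : ℝ) * (Xᵀ * X).det := h ▸ Finset.sum_nonneg fun _ _ => sq_nonneg _
  exact nonneg_of_mul_nonneg_right this (by positivity)

/-- The Cauchy–Schwarz inequality for determinants. -/
theorem sq_det_mul_le {k : ℕ} {ι : Type*} [Fintype ι] [DecidableEq ι]
    (A : Matrix (Fin k) ι ℝ) (B : Matrix ι (Fin k) ℝ) :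
    (A * B).det ^ 2 ≤ (A * Aᵀ).det * (Bᵀ * B).det := by
  have hk : (0 : ℝ) < (k.factorial : ℝ) := by positivity
  have h1 := factorial_mul_det_mul A B
  have h2 : (k.factorial : ℝ) * (A * Aᵀ).det =
      ∑ f : Fin k → ι, (A.submatrix id f).det ^ 2 := by
    have := factorial_mul_det_transpose_mul_self Aᵀ
    rw [Matrix.transpose_transpose] at this
    rw [this]
    refine Finset.sum_congr rfl fun f _ => ?_
    rw [← Matrix.det_transpose]
    rfl
  have h3 := factorial_mul_det_transpose_mul_self B
  have h4 := Finset.sum_mul_sq_le_sq_mul_sq Finset.univ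
    (fun f : Fin k → ι => (A.submatrix id f).det) (fun f => (B.submatrix f id).det)
  rw [← h1, ← h2, ← h3] at h4
  have : (k.factorial : ℝ) ^ 2 * (A * B).det ^ 2 ≤
      (k.factorial : ℝ) ^ 2 * ((A * Aᵀ).det * (Bᵀ * B).det) := by
    linarith
  exact le_of_mul_le_mul_left this (by positivity)

/-- A weak form of Hadamard's inequality. -/
theorem det_transpose_mul_self_le {k : ℕ} {ι : Type*} [Fintype ι] [DecidableEq ι]
    (X : Matrix ι (Fin k) ℝ) {b : ℝ} (hX : ∀ j, ∑ i, X i j ^ 2 ≤ b) :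
    (Xᵀ * X).det ≤ b ^ k := by
  rcases Nat.eq_zero_or_pos k with rfl | hk
  · simp
  have hpsd : (Xᵀ * X).PosSemidef := by
    simpa using Matrix.posSemidef_conjTranspose_mul_self X
  have hdet := hpsd.isHermitian.det_eq_prod_eigenvalues
  have htr := hpsd.isHermitian.trace_eq_sum_eigenvalues
  simp only [RCLike.ofReal_real_eq_id, id] at hdet htr
  have htr2 : (Xᵀ * X).trace ≤ k * b := by
    calc (Xᵀ * X).trace = ∑ j, ∑ i, X i j ^ 2 := by
          simp [Matrix.trace, Matrix.mul_apply, sq]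
      _ ≤ ∑ _j : Fin k, b := Finset.sum_le_sum fun j _ => hX j
      _ = k * b := by simp
  have hkR : (0 : ℝ) < k := by exact_mod_cast hk
  -- With a uniform bound on the columns, AM–GM for the eigenvalues of the Gram matrix suffices:
  -- their sum is the trace.
  have am := Real.geom_mean_le_arith_mean_weighted Finset.univ (fun _ : Fin k => (1 : ℝ) / k)
    hpsd.isHermitian.eigenvalues (fun _ _ => by positivity) (by simp [hkR.ne'])
    (fun i _ => hpsd.eigenvalues_nonneg i)
  rw [Real.finsetProd_rpow _ _ (fun i _ => hpsd.eigenvalues_nonneg i), ← hdet,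
    ← Finset.mul_sum, ← htr] at am
  have h0 := det_transpose_mul_self_nonneg X
  have h5 : (Xᵀ * X).det ^ ((1 : ℝ) / k) ≤ b := by
    refine am.trans ?_
    rw [one_div, inv_mul_le_iff₀ hkR]
    exact htr2
  calc (Xᵀ * X).det = ((Xᵀ * X).det ^ ((1 : ℝ) / k)) ^ k := by
        rw [one_div, Real.rpow_inv_natCast_pow h0 hk.ne']
    _ ≤ b ^ k := pow_le_pow_left₀ (Real.rpow_nonneg h0 _) h5 k

/-- The determinant of a product is bounded by the row norms of the first factor and the column norms
of the second. -/
theorem abs_det_mul_le {k : ℕ} {ι : Type*} [Fintype ι] [DecidableEq ι]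
    (A : Matrix (Fin k) ι ℝ) (B : Matrix ι (Fin k) ℝ) {a b : ℝ} (ha : 0 ≤ a) (hb : 0 ≤ b)
    (hA : ∀ i, ∑ l, A i l ^ 2 ≤ a ^ 2) (hB : ∀ j, ∑ l, B l j ^ 2 ≤ b ^ 2) :
    |(A * B).det| ≤ (a * b) ^ k := by
  have h1 := det_transpose_mul_self_le Aᵀ hA
  have h2 := det_transpose_mul_self_le B hB
  rw [Matrix.transpose_transpose] at h1
  refine abs_le_of_sq_le_sq ((sq_det_mul_le A B).trans ?_) (by positivity)
  calc (A * Aᵀ).det * (Bᵀ * B).det ≤ (a ^ 2) ^ k * (b ^ 2) ^ k :=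
        mul_le_mul h1 h2 (det_transpose_mul_self_nonneg B) (by positivity)
    _ = ((a * b) ^ k) ^ 2 := by ring

/-! ### From products to sums. -/

/-- If all products of subfamilies are small, then so is the sum. -/
theorem sum_le_harmonic_of_prod_le {ι : Type*} [DecidableEq ι] (σ : ι → ℝ) {c : ℝ} (hc : 0 ≤ c)
    (s : Finset ι) (hσ : ∀ i ∈ s, 0 ≤ σ i)
    (h : ∀ t ⊆ s, ∏ i ∈ t, σ i ≤ c ^ #t / (#t).factorial) :
    ∑ i ∈ s, σ i ≤ c * Real.exp 1 * harmonic #s := by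
  induction hn : #s generalizing s with
  | zero =>
    rw [Finset.card_eq_zero] at hn
    simp [hn]
  | succ n ih =>
    -- Remove the smallest term: its `(n + 1)`-st power is at most the full product, and `N! ≥ (N /
    -- e) ^ N` bounds it by `c e / (n + 1)`.
    obtain ⟨i, hi, hmin⟩ := s.exists_min_image σ (Finset.card_pos.1 (by omega))
    have hlow : σ i ≤ c * Real.exp 1 / (n + 1 : ℕ) := by
      have h1 : σ i ^ (n + 1) ≤ ∏ j ∈ s, σ j := by
        rw [← hn, ← Finset.prod_const]
        exact Finset.prod_le_prod (fun _ _ => hσ i hi) fun j hj => hmin j hj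
      have h2 := h1.trans (h s subset_rfl)
      rw [hn] at h2
      have h3 := Real.pow_div_factorial_le_exp (x := (n + 1 : ℕ)) (by positivity) (n + 1)
      refine le_of_pow_le_pow_left₀ n.succ_ne_zero (by positivity) (h2.trans ?_)
      rw [div_pow, mul_pow, ← Real.exp_nat_mul, mul_one, div_le_div_iff₀ (by positivity)
        (by positivity), mul_assoc]
      refine mul_le_mul_of_nonneg_left ?_ (by positivity)
      rwa [div_le_iff₀ (by positivity)] at h3
    have h4 := ih (s.erase i) (fun j hj => hσ j (Finset.mem_of_mem_erase hj))
      (fun t ht => h t (ht.trans (Finset.erase_subset _ _)))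
      (by rw [Finset.card_erase_of_mem hi, hn]; rfl)
    rw [← Finset.sum_erase_add _ _ hi, harmonic_succ]
    push_cast at hlow ⊢
    rw [mul_add, ← div_eq_mul_inv]
    exact add_le_add h4 hlow

/-! ### Operator norms as maximal row and column lengths, and `detlb ≤ γ₂`. -/

theorem opNorm_nonneg (p q : ℝ≥0∞) [Fact (1 ≤ p)] [Fact (1 ≤ q)] {m n : ℕ}
    (M : Matrix (Fin m) (Fin n) ℝ) : 0 ≤ opNorm p q M := norm_nonneg _

theorem opNorm_two_top_le {m n : ℕ} (M : Matrix (Fin m) (Fin n) ℝ) {t : ℝ} (ht : 0 ≤ t)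
    (h : ∀ i, ∑ l, M i l ^ 2 ≤ t) : opNorm 2 ∞ M ≤ √t := by
  refine ContinuousLinearMap.opNorm_le_bound _ (Real.sqrt_nonneg _) fun x => ?_
  simp only [LinearMap.coe_toContinuousLinearMap', Matrix.toLpLin_apply, PiLp.norm_toLp]
  refine (pi_norm_le_iff_of_nonneg (by positivity)).2 fun i => ?_
  rw [EuclideanSpace.norm_eq, ← Real.sqrt_mul ht]
  refine Real.abs_le_sqrt ((Finset.sum_mul_sq_le_sq_mul_sq Finset.univ (M i) x.ofLp).trans ?_)
  simp only [Real.norm_eq_abs, sq_abs]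
  exact mul_le_mul_of_nonneg_right (h i) (Finset.sum_nonneg fun _ _ => sq_nonneg _)

/-- A row is its own extremal test vector: applying `M` to it gives `s ≤ ‖M‖ √s`. -/
theorem sum_sq_row_le {m n : ℕ} (M : Matrix (Fin m) (Fin n) ℝ) (i : Fin m) :
    ∑ l, M i l ^ 2 ≤ opNorm 2 ∞ M ^ 2 := by
  set s := ∑ l, M i l ^ 2 with hs
  have hs0 : 0 ≤ s := Finset.sum_nonneg fun _ _ => sq_nonneg _
  have h1 := ContinuousLinearMap.le_opNorm
    (LinearMap.toContinuousLinearMap (Matrix.toLpLin 2 ∞ M)) (WithLp.toLp 2 (M i))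
  simp only [LinearMap.coe_toContinuousLinearMap', Matrix.toLpLin_apply, PiLp.norm_toLp] at h1
  have h2 := (norm_le_pi_norm (M *ᵥ M i) i).trans h1
  rw [EuclideanSpace.norm_eq] at h2
  have h3 : (M *ᵥ M i) i = s := by simp [Matrix.mulVec, dotProduct, hs, sq]
  simp only [h3, Real.norm_eq_abs, sq_abs, abs_of_nonneg hs0, ← hs] at h2
  change s ≤ opNorm 2 ∞ M * √s at h2
  rcases hs0.eq_or_lt with h | h
  · rw [← h]; positivity
  · have h4 : √s ≤ opNorm 2 ∞ M := by
      have : √s * √s ≤ opNorm 2 ∞ M * √s := by rwa [Real.mul_self_sqrt hs0]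
      exact le_of_mul_le_mul_right this (Real.sqrt_pos.2 h)
    calc s = √s ^ 2 := (Real.sq_sqrt hs0).symm
      _ ≤ _ := pow_le_pow_left₀ (Real.sqrt_nonneg _) h4 2

theorem opNorm_one_two_le {m n : ℕ} (M : Matrix (Fin m) (Fin n) ℝ) {t : ℝ}
    (h : ∀ j, ∑ l, M l j ^ 2 ≤ t) : opNorm 1 2 M ≤ √t := by
  refine ContinuousLinearMap.opNorm_le_bound _ (Real.sqrt_nonneg _) fun x => ?_
  simp only [LinearMap.coe_toContinuousLinearMap', Matrix.toLpLin_apply]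
  have h1 : WithLp.toLp 2 (M *ᵥ x.ofLp) = ∑ j, x j • WithLp.toLp 2 (fun l => M l j) := by
    ext l
    simp [Matrix.mulVec, dotProduct, mul_comm]
  have h2 : ‖x‖ = ∑ j, |x j| := by
    simpa using PiLp.norm_eq_of_nat 1 (by simp) x
  rw [h1, h2, Finset.mul_sum]
  refine (norm_sum_le _ _).trans (Finset.sum_le_sum fun j _ => ?_)
  rw [norm_smul, mul_comm, Real.norm_eq_abs]
  refine mul_le_mul_of_nonneg_right ?_ (abs_nonneg _)
  rw [EuclideanSpace.norm_eq]
  exact Real.sqrt_le_sqrt (by simpa using h j)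

theorem sum_sq_col_le {m n : ℕ} (M : Matrix (Fin m) (Fin n) ℝ) (j : Fin n) :
    ∑ l, M l j ^ 2 ≤ opNorm 1 2 M ^ 2 := by
  have h1 := ContinuousLinearMap.le_opNorm
    (LinearMap.toContinuousLinearMap (Matrix.toLpLin 1 2 M)) (WithLp.toLp 1 (Pi.single j (1 : ℝ)))
  have h2 : ‖(WithLp.toLp 1 (Pi.single j (1 : ℝ)) : PiLp 1 fun _ : Fin n => ℝ)‖ = 1 := by
    simp
  rw [h2, mul_one] at h1
  simp only [LinearMap.coe_toContinuousLinearMap', Matrix.toLpLin_apply,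
    Matrix.mulVec_single_one] at h1
  have h3 := pow_le_pow_left₀ (norm_nonneg _) h1 2
  rw [EuclideanSpace.norm_sq_eq] at h3
  simp only [Real.norm_eq_abs, sq_abs] at h3
  exact h3

theorem gammaTwo_le_of_factorization {m n k : ℕ} {A : Matrix (Fin m) (Fin n) ℝ}
    (B : Matrix (Fin m) (Fin k) ℝ) (C : Matrix (Fin k) (Fin n) ℝ) (h : A = B * C) {t : ℝ}
    (ht : 0 ≤ t) (hB : ∀ i, ∑ l, B i l ^ 2 ≤ t) (hC : ∀ j, ∑ l, C l j ^ 2 ≤ t) :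
    gammaTwo A ≤ t := by
  have hle : gammaTwo A ≤ opNorm 2 ∞ B * opNorm 1 2 C := by
    refine csInf_le ⟨0, ?_⟩ ⟨k, B, C, h, rfl⟩
    rintro _ ⟨k, B, C, -, rfl⟩
    exact mul_nonneg (opNorm_nonneg _ _ _) (opNorm_nonneg _ _ _)
  refine hle.trans ?_
  calc opNorm 2 ∞ B * opNorm 1 2 C ≤ √t * √t :=
        mul_le_mul (opNorm_two_top_le B ht hB) (opNorm_one_two_le C hC) (opNorm_nonneg _ _ _)
          (Real.sqrt_nonneg _)
      _ = t := Real.mul_self_sqrt ht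

theorem rpow_det_submatrix_le {m n l : ℕ} {A : Matrix (Fin m) (Fin n) ℝ}
    (B : Matrix (Fin m) (Fin l) ℝ) (C : Matrix (Fin l) (Fin n) ℝ) (h : A = B * C)
    {k : ℕ} (hk : 1 ≤ k) (f : Fin k → Fin m) (g : Fin k → Fin n) :
    |(A.submatrix f g).det| ^ (1 / (k : ℝ)) ≤ opNorm 2 ∞ B * opNorm 1 2 C := by
  have h0 : 0 ≤ opNorm 2 ∞ B * opNorm 1 2 C :=
    mul_nonneg (opNorm_nonneg _ _ _) (opNorm_nonneg _ _ _)
  have h1 : A.submatrix f g = B.submatrix f id * C.submatrix id g := by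
    rw [h, Matrix.submatrix_mul _ _ _ _ _ Function.bijective_id]
  have h2 := abs_det_mul_le (B.submatrix f id) (C.submatrix id g) (opNorm_nonneg 2 ∞ B)
    (opNorm_nonneg 1 2 C) (fun i => sum_sq_row_le B (f i)) (fun j => sum_sq_col_le C (g j))
  rw [h1]
  calc _ ≤ ((opNorm 2 ∞ B * opNorm 1 2 C) ^ k) ^ (1 / (k : ℝ)) :=
        Real.rpow_le_rpow (abs_nonneg _) h2 (by positivity)
    _ = _ := by rw [one_div, Real.pow_rpow_inv_natCast h0 (by omega)]

theorem detlb_le_gammaTwo {m n : ℕ} (A : Matrix (Fin m) (Fin n) ℝ) : detlb A ≤ gammaTwo A := by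
  refine le_csInf ⟨_, n, A, 1, by simp, rfl⟩ ?_
  rintro _ ⟨l, B, C, h, rfl⟩
  -- Nonnegativity of the bound covers the case of no minors, where the supremum is 0.
  refine Real.sSup_le ?_ (mul_nonneg (opNorm_nonneg _ _ _) (opNorm_nonneg _ _ _))
  rintro _ ⟨k, hk, f, g, rfl⟩
  exact rpow_det_submatrix_le B C h hk f g

theorem detlb_nonneg {m n : ℕ} (A : Matrix (Fin m) (Fin n) ℝ) : 0 ≤ detlb A := by
  refine Real.sSup_nonneg ?_
  rintro _ ⟨k, hk, f, g, rfl⟩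
  positivity

/-- Cauchy–Binet is summed over all functions, so minors with repeated or unsorted indices must be
bounded too: repetition gives determinant 0, and sorting only changes the sign. -/
theorem abs_det_submatrix_le {m n : ℕ} (A : Matrix (Fin m) (Fin n) ℝ) {k : ℕ}
    (f : Fin k → Fin m) (g : Fin k → Fin n) : |(A.submatrix f g).det| ≤ detlb A ^ k := by
  rcases Nat.eq_zero_or_pos k with rfl | hk
  · simp
  by_cases hf : Function.Injective f
  · by_cases hg : Function.Injective g
    · have hf' : StrictMono (f ∘ Tuple.sort f) :=
        (Tuple.monotone_sort f).strictMono_of_injective (hf.comp (Equiv.injective _))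
      have hg' : StrictMono (g ∘ Tuple.sort g) :=
        (Tuple.monotone_sort g).strictMono_of_injective (hg.comp (Equiv.injective _))
      have h1 : |(A.submatrix (f ∘ Tuple.sort f) (g ∘ Tuple.sort g)).det| ^ (1 / (k : ℝ)) ≤
          detlb A := by
        refine le_csSup ⟨opNorm 2 ∞ A * opNorm 1 2 (1 : Matrix (Fin n) (Fin n) ℝ), ?_⟩
          ⟨k, hk, OrderEmbedding.ofStrictMono _ hf', OrderEmbedding.ofStrictMono _ hg', rfl⟩
        rintro _ ⟨k, hk, f, g, rfl⟩
        exact rpow_det_submatrix_le A 1 (by simp) hk f g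
      rw [← Matrix.submatrix_submatrix, Matrix.abs_det_submatrix_equiv_equiv] at h1
      have h2 := pow_le_pow_left₀ (by positivity) h1 k
      rwa [one_div, Real.rpow_inv_natCast_pow (abs_nonneg _) hk.ne'] at h2
    · rw [Function.not_injective_iff] at hg
      obtain ⟨i, j, hij, hne⟩ := hg
      rw [Matrix.det_zero_of_column_eq hne (by simp [hij]), abs_zero]
      exact pow_nonneg (detlb_nonneg A) k
  · rw [Function.not_injective_iff] at hf
    obtain ⟨i, j, hij, hne⟩ := hf
    rw [Matrix.det_zero_of_row_eq hne (by ext; simp [hij]), abs_zero]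
    exact pow_nonneg (detlb_nonneg A) k

/-! ### Singular values and the weighted factorization. -/

/-- An orthonormal basis of eigenvectors of `Mᵀ M`. -/
theorem exists_orthogonal_diagonalization {m n : ℕ} (M : Matrix (Fin m) (Fin n) ℝ) :
    ∃ (V : Matrix (Fin n) (Fin n) ℝ) (s : Fin n → ℝ), (∀ j, 0 ≤ s j) ∧ Vᵀ * V = 1 ∧ V * Vᵀ = 1 ∧
      (M * V)ᵀ * (M * V) = diagonal (fun j => s j ^ 2) ∧ #{j | s j ≠ 0} = M.rank := by
  have hpsd : (Mᵀ * M).PosSemidef := by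
    simpa using Matrix.posSemidef_conjTranspose_mul_self M
  set hG := hpsd.isHermitian
  set V : Matrix (Fin n) (Fin n) ℝ := (hG.eigenvectorUnitary).1 with hV
  have h1 : Vᵀ * V = 1 := by
    simpa [Matrix.star_eq_conjTranspose] using Unitary.coe_star_mul_self hG.eigenvectorUnitary
  have h2 : V * Vᵀ = 1 := by
    simpa [Matrix.star_eq_conjTranspose] using Unitary.coe_mul_star_self hG.eigenvectorUnitary
  refine ⟨V, fun j => √(hG.eigenvalues j), fun j => Real.sqrt_nonneg _, h1, h2, ?_, ?_⟩
  · have h3 : Mᵀ * M * V = V * diagonal hG.eigenvalues := by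
      have h := hG.spectral_theorem
      rw [Unitary.conjStarAlgAut_apply, ← hV, Matrix.star_eq_conjTranspose,
        Matrix.conjTranspose_eq_transpose_of_trivial] at h
      calc Mᵀ * M * V = V * diagonal hG.eigenvalues * Vᵀ * V := by
            congr 1
        _ = _ := by rw [Matrix.mul_assoc, h1, Matrix.mul_one]
    rw [Matrix.transpose_mul, Matrix.mul_assoc, ← Matrix.mul_assoc Mᵀ, h3, ← Matrix.mul_assoc, h1,
      Matrix.one_mul]
    congr 1
    ext j
    exact (Real.sq_sqrt (hpsd.eigenvalues_nonneg j)).symm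
  · rw [← Matrix.rank_transpose_mul_self M, hG.rank_eq_card_non_zero_eigs, Fintype.card_subtype]
    congr 1
    ext j
    simp [Real.sqrt_eq_zero (hpsd.eigenvalues_nonneg j)]

theorem diagonal_mul_mul_diagonal_submatrix_det {m n k : ℕ} (A : Matrix (Fin m) (Fin n) ℝ)
    (p : Fin m → ℝ) (q : Fin n → ℝ) (f : Fin k → Fin m) (g : Fin k → Fin n) :
    ((diagonal p * A * diagonal q).submatrix f g).det =
      (∏ i, p (f i)) * (∏ i, q (g i)) * (A.submatrix f g).det := by
  have : (diagonal p * A * diagonal q).submatrix f g =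
      diagonal (p ∘ f) * A.submatrix f g * diagonal (q ∘ g) := by
    ext i j
    simp
  rw [this, Matrix.det_mul, Matrix.det_mul, Matrix.det_diagonal, Matrix.det_diagonal]
  simp only [Function.comp_apply]
  ring

/-- Products of singular values of a matrix rescaled by nonnegative weights are bounded in terms
of the determinant lower bound. -/
theorem prod_le_of_orthogonal_diagonalization {m n : ℕ} (A : Matrix (Fin m) (Fin n) ℝ)
    {p : Fin m → ℝ} {q : Fin n → ℝ} (hp : ∀ i, 0 ≤ p i) (hq : ∀ j, 0 ≤ q j)
    {V : Matrix (Fin n) (Fin n) ℝ} {s : Fin n → ℝ} (hV : Vᵀ * V = 1)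
    (hM : (diagonal (fun i => √(p i)) * A * diagonal (fun j => √(q j)) * V)ᵀ *
      (diagonal (fun i => √(p i)) * A * diagonal (fun j => √(q j)) * V) =
        diagonal (fun j => s j ^ 2)) (t : Finset (Fin n)) :
    ∏ j ∈ t, s j ≤ ((∑ i, p i + ∑ j, q j) / 2 * detlb A) ^ #t / (#t).factorial := by
  set M := diagonal (fun i => √(p i)) * A * diagonal (fun j => √(q j)) with hMdef
  obtain ⟨k, hk⟩ : ∃ k, #t = k := ⟨_, rfl⟩
  rw [hk]
  set e := t.orderEmbOfFin hk
  have hD := detlb_nonneg A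
  have hp0 : 0 ≤ ∑ i, p i := Finset.sum_nonneg fun i _ => hp i
  have hq0 : 0 ≤ ∑ j, q j := Finset.sum_nonneg fun j _ => hq j
  have hprod : ∏ j ∈ t, s j = ∏ i, s (e i) := by
    rw [← Finset.image_orderEmbOfFin_univ t hk, Finset.prod_image e.injective.injOn]
  have hkf : (0 : ℝ) < k.factorial := by positivity
  have hVe : (V.submatrix id e)ᵀ * V.submatrix id e = 1 := by
    have : (V.submatrix id e)ᵀ * V.submatrix id e = (Vᵀ * V).submatrix e e := rfl
    rw [this, hV, Matrix.submatrix_one _ e.injective]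
  have hX : ((M * V.submatrix id e)ᵀ * (M * V.submatrix id e)).det = (∏ i, s (e i)) ^ 2 := by
    have : (M * V.submatrix id e)ᵀ * (M * V.submatrix id e) =
      ((M * V)ᵀ * (M * V)).submatrix e e := rfl
    rw [this, hM, Matrix.submatrix_diagonal _ _ e.injective, Matrix.det_diagonal,
      ← Finset.prod_pow]
    rfl
  -- The selected columns of `V` are orthonormal, so Cauchy–Schwarz removes them; Cauchy–Binet then
  -- expands the Gram determinant of the rows.
  have hrow (f : Fin k → Fin m) : (k.factorial : ℝ) * ((M * V.submatrix id e).submatrix f id).det ^ 2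
      ≤ ∑ g : Fin k → Fin n, (M.submatrix f g).det ^ 2 := by
    have h1 := sq_det_mul_le (M.submatrix f id) (V.submatrix id e)
    rw [hVe, Matrix.det_one, mul_one] at h1
    have h2 := factorial_mul_det_mul (M.submatrix f id) (M.submatrix f id)ᵀ
    have h3 : ∑ g : Fin k → Fin n, (M.submatrix f g).det ^ 2 =
        (k.factorial : ℝ) * (M.submatrix f id * (M.submatrix f id)ᵀ).det := by
      rw [h2]
      refine Finset.sum_congr rfl fun g _ => ?_
      rw [sq]
      congr 1
      rw [← Matrix.det_transpose]
      rfl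
    rw [h3]
    exact mul_le_mul_of_nonneg_left h1 hkf.le
  have hminor (f : Fin k → Fin m) (g : Fin k → Fin n) : (M.submatrix f g).det ^ 2 ≤
      (∏ i, p (f i)) * (∏ i, q (g i)) * (detlb A ^ k) ^ 2 := by
    rw [hMdef, diagonal_mul_mul_diagonal_submatrix_det, mul_pow, mul_pow, ← Finset.prod_pow,
      ← Finset.prod_pow]
    simp only [Real.sq_sqrt (hp _), Real.sq_sqrt (hq _)]
    refine mul_le_mul_of_nonneg_left ?_ (mul_nonneg (Finset.prod_nonneg fun _ _ => hp _)
      (Finset.prod_nonneg fun _ _ => hq _))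
    exact sq_le_sq.2 ((abs_det_submatrix_le A f g).trans (le_abs_self _))
  have hmain : ((k.factorial : ℝ) * ∏ i, s (e i)) ^ 2 ≤
      (((∑ i, p i + ∑ j, q j) / 2 * detlb A) ^ k) ^ 2 := by
    calc ((k.factorial : ℝ) * ∏ i, s (e i)) ^ 2
        = k.factorial * (k.factorial *
          ((M * V.submatrix id e)ᵀ * (M * V.submatrix id e)).det) := by rw [hX]; ring
      _ = ∑ f : Fin k → Fin m,
          k.factorial * ((M * V.submatrix id e).submatrix f id).det ^ 2 := by
        rw [factorial_mul_det_transpose_mul_self, Finset.mul_sum]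
      _ ≤ ∑ f : Fin k → Fin m, ∑ g : Fin k → Fin n,
          (∏ i, p (f i)) * (∏ i, q (g i)) * (detlb A ^ k) ^ 2 :=
        Finset.sum_le_sum fun f _ => (hrow f).trans (Finset.sum_le_sum fun g _ => hminor f g)
      _ = ((∑ i, p i) * (∑ j, q j)) ^ k * (detlb A ^ k) ^ 2 := by
        simp only [← Finset.sum_mul, ← Finset.mul_sum]
        rw [← Fintype.sum_pow, ← Fintype.sum_pow, mul_pow]
      _ ≤ (((∑ i, p i + ∑ j, q j) / 2) ^ 2) ^ k * (detlb A ^ k) ^ 2 := by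
        refine mul_le_mul_of_nonneg_right (pow_le_pow_left₀ (mul_nonneg hp0 hq0) ?_ k)
          (by positivity)
        -- AM–GM: `P Q ≤ ((P + Q) / 2) ^ 2` for the two total weights.
        nlinarith [sq_nonneg (∑ i, p i - ∑ j, q j)]
      _ = _ := by rw [mul_pow _ (detlb A) k, mul_pow _ _ 2, pow_right_comm]
  rw [hprod, le_div_iff₀ hkf, mul_comm]
  exact le_of_sq_le_sq hmain (by positivity)

/-- For every choice of positive weights, there is a factorization whose weighted sum of squared
row and column norms is controlled by the determinant lower bound. -/
theorem exists_factorization_weighted {m n : ℕ} (A : Matrix (Fin m) (Fin n) ℝ)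
    {p : Fin m → ℝ} {q : Fin n → ℝ} (hp : ∀ i, 0 < p i) (hq : ∀ j, 0 < q j) :
    ∃ (B : Matrix (Fin m) (Fin n) ℝ) (C : Matrix (Fin n) (Fin n) ℝ), A = B * C ∧
      ∑ i, p i * ∑ l, B i l ^ 2 + ∑ j, q j * ∑ l, C l j ^ 2 ≤
        Real.exp 1 * harmonic A.rank * detlb A * (∑ i, p i + ∑ j, q j) := by
  set M := diagonal (fun i => √(p i)) * A * diagonal (fun j => √(q j)) with hMdef
  obtain ⟨V, s, hs, hV, hV', hM, hcard⟩ := exists_orthogonal_diagonalization M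
  have hD := detlb_nonneg A
  have hp0 : 0 ≤ ∑ i, p i := Finset.sum_nonneg fun i _ => (hp i).le
  have hq0 : 0 ≤ ∑ j, q j := Finset.sum_nonneg fun j _ => (hq j).le
  have hrank : M.rank ≤ A.rank :=
    (Matrix.rank_mul_le_left _ _).trans (Matrix.rank_mul_le_right _ _)
  -- Only nonzero singular values enter, so the harmonic number depends on the rank and not on `n`.
  have hsum : ∑ j, s j ≤ (∑ i, p i + ∑ j, q j) / 2 * detlb A * Real.exp 1 * harmonic A.rank := by
    have h1 := sum_le_harmonic_of_prod_le s (c := (∑ i, p i + ∑ j, q j) / 2 * detlb A)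
      (by positivity) {j | s j ≠ 0} (fun j _ => hs j) (fun t _ =>
        prod_le_of_orthogonal_diagonalization A (fun i => (hp i).le) (fun j => (hq j).le)
          hV hM t)
    rw [hcard, Finset.sum_filter_ne_zero] at h1
    refine h1.trans (mul_le_mul_of_nonneg_left ?_ (by positivity))
    have : harmonic M.rank ≤ harmonic A.rank :=
      Finset.sum_le_sum_of_subset_of_nonneg (by simpa using hrank) fun _ _ _ => by positivity
    exact_mod_cast this
  have hcol (l : Fin n) : ∑ i, (M * V) i l ^ 2 = s l ^ 2 := by
    have := congrFun (congrFun hM l) l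
    rw [Matrix.mul_apply, Matrix.diagonal_apply_eq] at this
    rw [← this]
    exact Finset.sum_congr rfl fun i _ => sq _
  have hcolV (l : Fin n) : ∑ j, V j l ^ 2 = 1 := by
    have := congrFun (congrFun hV l) l
    simpa [Matrix.mul_apply, ← sq] using this
  -- Where `s l = 0` the inverse is 0 by convention, but the column `l` of `M * V` vanishes as well.
  have hzero : M * V * diagonal (fun l => (√(s l))⁻¹) * diagonal (fun l => √(s l)) = M * V := by
    ext i l
    rw [Matrix.mul_diagonal, Matrix.mul_diagonal]
    by_cases h : s l = 0
    · have h2 := hcol l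
      rw [h, zero_pow two_ne_zero, Finset.sum_eq_zero_iff_of_nonneg fun _ _ => sq_nonneg _] at h2
      rw [pow_eq_zero_iff two_ne_zero |>.1 (h2 i (Finset.mem_univ i))]
      simp
    · rw [mul_assoc, inv_mul_cancel₀ (Real.sqrt_ne_zero'.2 ((hs l).lt_of_ne' h)), mul_one]
  -- With `M = U S Vᵀ`, these are the unweighted forms of `U √S` and `√S Vᵀ`. Each contributes
  -- exactly `∑ s` to the weighted sum.
  refine ⟨diagonal (fun i => (√(p i))⁻¹) * (M * V * diagonal (fun l => (√(s l))⁻¹)),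
    diagonal (fun l => √(s l)) * Vᵀ * diagonal (fun j => (√(q j))⁻¹), ?_, ?_⟩
  · have h1 : diagonal (fun i => (√(p i))⁻¹) * diagonal (fun i => √(p i)) = 1 := by
      rw [Matrix.diagonal_mul_diagonal, ← Matrix.diagonal_one]
      congr 1
      ext i
      exact inv_mul_cancel₀ (Real.sqrt_ne_zero'.2 (hp i))
    have h2 : diagonal (fun j => √(q j)) * diagonal (fun j => (√(q j))⁻¹) = 1 := by
      rw [Matrix.diagonal_mul_diagonal, ← Matrix.diagonal_one]
      congr 1
      ext j
      exact mul_inv_cancel₀ (Real.sqrt_ne_zero'.2 (hq j))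
    symm
    calc _ = diagonal (fun i => (√(p i))⁻¹) * ((M * V * diagonal (fun l => (√(s l))⁻¹) *
          diagonal (fun l => √(s l))) * Vᵀ) * diagonal (fun j => (√(q j))⁻¹) := by
            simp only [Matrix.mul_assoc]
      _ = (diagonal (fun i => (√(p i))⁻¹) * diagonal (fun i => √(p i))) * A *
          (diagonal (fun j => √(q j)) * diagonal (fun j => (√(q j))⁻¹)) := by
            rw [hzero, Matrix.mul_assoc M, hV', Matrix.mul_one, hMdef]
            simp only [Matrix.mul_assoc]
      _ = A := by rw [h1, h2, Matrix.one_mul, Matrix.mul_one]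
  · have hB : ∑ i, p i * ∑ l, (diagonal (fun i => (√(p i))⁻¹) *
        (M * V * diagonal (fun l => (√(s l))⁻¹))) i l ^ 2 = ∑ l, s l := by
      simp only [Finset.mul_sum]
      rw [Finset.sum_comm]
      refine Finset.sum_congr rfl fun l _ => ?_
      calc _ = ∑ i, (M * V) i l ^ 2 * (s l)⁻¹ := by
            refine Finset.sum_congr rfl fun i _ => ?_
            rw [Matrix.diagonal_mul, Matrix.mul_diagonal, mul_pow, mul_pow, inv_pow, inv_pow,
              Real.sq_sqrt (hp i).le, Real.sq_sqrt (hs l), mul_inv_cancel_left₀ (hp i).ne']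
        _ = s l := by
            rw [← Finset.sum_mul, hcol]
            by_cases h : s l = 0
            · simp [h]
            · field_simp
    have hC : ∑ j, q j * ∑ l, (diagonal (fun l => √(s l)) * Vᵀ *
        diagonal (fun j => (√(q j))⁻¹)) l j ^ 2 = ∑ l, s l := by
      simp only [Finset.mul_sum]
      rw [Finset.sum_comm]
      refine Finset.sum_congr rfl fun l _ => ?_
      calc _ = ∑ j, s l * V j l ^ 2 := by
            refine Finset.sum_congr rfl fun j _ => ?_
            rw [Matrix.mul_diagonal, Matrix.diagonal_mul, mul_pow, mul_pow, inv_pow,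
              Real.sq_sqrt (hq j).le, Real.sq_sqrt (hs l), Matrix.transpose_apply]
            have := (hq j).ne'
            field_simp
        _ = s l := by rw [← Finset.mul_sum, hcolV, mul_one]
    rw [hB, hC]
    linarith

/-! ### Duality for `γ₂` by separation of convex sets. -/

/-- The strict upward closure of the set of all squared row and column norms of factorizations
of `A`. -/
def factorizationProfiles {m n : ℕ} (A : Matrix (Fin m) (Fin n) ℝ) : Set (Fin m ⊕ Fin n → ℝ) :=
  {v | ∃ (k : ℕ) (B : Matrix (Fin m) (Fin k) ℝ) (C : Matrix (Fin k) (Fin n) ℝ), A = B * C ∧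
    (∀ i, ∑ l, B i l ^ 2 < v (.inl i)) ∧ ∀ j, ∑ l, C l j ^ 2 < v (.inr j)}

theorem isOpen_factorizationProfiles {m n : ℕ} (A : Matrix (Fin m) (Fin n) ℝ) :
    IsOpen (factorizationProfiles A) := by
  simp only [factorizationProfiles, Set.ofPred_exists]
  refine isOpen_iUnion fun k => isOpen_iUnion fun B => isOpen_iUnion fun C => ?_
  simp only [Set.ofPred_and, Set.ofPred_forall]
  refine isOpen_const.inter ((isOpen_iInter_of_finite fun i => ?_).inter
    (isOpen_iInter_of_finite fun j => ?_))
  · exact isOpen_lt continuous_const (continuous_apply _)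
  · exact isOpen_lt continuous_const (continuous_apply _)

/-- Put the two factorizations side by side, scaled by `√a` and `√b`: the product is `a A + b A =
A`, and squared norms combine convexly. This needs the inner dimension to be free. -/
theorem convex_factorizationProfiles {m n : ℕ} (A : Matrix (Fin m) (Fin n) ℝ) :
    Convex ℝ (factorizationProfiles A) := by
  rintro u ⟨k₁, B₁, C₁, h₁, hu₁, hu₂⟩ v ⟨k₂, B₂, C₂, h₂, hv₁, hv₂⟩ a b ha hb hab
  -- Convexity of the open half-line keeps the inequality strict even if `a` or `b` is 0.
  have key {x y x' y' : ℝ} (hx : x < x') (hy : y < y') : a * x + b * y < a * x' + b * y' := by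
    have := (convex_Ioi (0 : ℝ)) (sub_pos.2 hx) (sub_pos.2 hy) ha hb hab
    simp only [smul_eq_mul, Set.mem_Ioi] at this
    linarith
  refine ⟨k₁ + k₂, .of fun i => Fin.append (fun l => √a * B₁ i l) (fun l => √b * B₂ i l),
    .of fun l j => Fin.append (fun l => √a * C₁ l j) (fun l => √b * C₂ l j) l, ?_, fun i => ?_,
    fun j => ?_⟩
  · ext i j
    have h₁' := congrFun (congrFun h₁ i) j
    have h₂' := congrFun (congrFun h₂ i) j
    rw [Matrix.mul_apply] at h₁' h₂' ⊢
    have hsqrt {c : ℝ} (hc : 0 ≤ c) (x y : ℝ) : √c * x * (√c * y) = c * (x * y) := by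
      rw [mul_mul_mul_comm, Real.mul_self_sqrt hc]
    simp only [Matrix.of_apply, Fin.sum_univ_add, Fin.append_left, Fin.append_right, hsqrt ha,
      hsqrt hb, ← Finset.mul_sum, ← h₁', ← h₂']
    rw [← add_mul, hab, one_mul]
  · simp only [Matrix.of_apply, Fin.sum_univ_add, Fin.append_left, Fin.append_right, mul_pow, Real.sq_sqrt ha,
      Real.sq_sqrt hb, ← Finset.mul_sum]
    exact key (hu₁ i) (hv₁ i)
  · simp only [Matrix.of_apply, Fin.sum_univ_add, Fin.append_left, Fin.append_right, mul_pow, Real.sq_sqrt ha,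
      Real.sq_sqrt hb, ← Finset.mul_sum]
    exact key (hu₂ j) (hv₂ j)

/-- Duality for `γ₂`: if for all positive weights there is a factorization whose weighted sum of
squared row and column norms is at most `T` times the total weight, then `γ₂(A) ≤ T`. -/
theorem gammaTwo_le_of_forall_weighted {m n : ℕ} (A : Matrix (Fin m) (Fin n) ℝ) {T : ℝ}
    (hT : 0 ≤ T)
    (h : ∀ (p : Fin m → ℝ) (q : Fin n → ℝ), (∀ i, 0 < p i) → (∀ j, 0 < q j) →
      ∃ (k : ℕ) (B : Matrix (Fin m) (Fin k) ℝ) (C : Matrix (Fin k) (Fin n) ℝ), A = B * C ∧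
        ∑ i, p i * ∑ l, B i l ^ 2 + ∑ j, q j * ∑ l, C l j ^ 2 ≤ T * (∑ i, p i + ∑ j, q j)) :
    gammaTwo A ≤ T := by
  by_contra! hlt
  obtain ⟨t, hTt, htγ⟩ := exists_between hlt
  have hmem : (fun _ => t) ∉ factorizationProfiles A := by
    rintro ⟨k, B, C, hA, hB, hC⟩
    exact htγ.not_ge (gammaTwo_le_of_factorization B C hA (hT.trans hTt.le)
      (fun i => (hB i).le) fun j => (hC j).le)
  obtain ⟨f, hf⟩ := geometric_hahn_banach_open_point (convex_factorizationProfiles A)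
    (isOpen_factorizationProfiles A) hmem
  -- The coefficients of the separating functional, with sign reversed, are the dual weights.
  set w : Fin m ⊕ Fin n → ℝ := fun i => -f (fun j => if i = j then 1 else 0) with hw
  have hfw (v : Fin m ⊕ Fin n → ℝ) : f v = -∑ i, w i * v i := by
    have := f.toLinearMap.pi_apply_eq_sum_univ v
    simp only [ContinuousLinearMap.coe_coe, smul_eq_mul] at this
    rw [this, hw, ← Finset.sum_neg_distrib]
    exact Finset.sum_congr rfl fun i _ => by ring
  have hsep (v) (hv : v ∈ factorizationProfiles A) : t * ∑ i, w i < ∑ i, w i * v i := by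
    have := hf v hv
    rw [hfw, hfw, ← Finset.sum_mul] at this
    linarith
  obtain ⟨v₀, k₀, B₀, C₀, hA₀, hB₀, hC₀⟩ : (factorizationProfiles A).Nonempty := by
    refine ⟨Sum.elim (fun i => ∑ l, A i l ^ 2 + 1)
      (fun j => ∑ l, (1 : Matrix (Fin n) (Fin n) ℝ) l j ^ 2 + 1), n, A, 1, by simp, ?_, ?_⟩
    · intro i
      simp only [Sum.elim_inl]
      linarith
    · intro j
      simp only [Sum.elim_inr]
      linarith
  -- The profiles are upward closed; were `w i` negative, raising coordinate `i` by `c` would lower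
  -- the functional exactly to the separating value.
  have hw0 (i) : 0 ≤ w i := by
    by_contra! hi
    set c := (∑ i, w i * v₀ i - t * ∑ i, w i) / (-w i) with hc
    have hc0 : 0 < c := div_pos (sub_pos.2 (hsep _ ⟨k₀, B₀, C₀, hA₀, hB₀, hC₀⟩)) (by linarith)
    have hle (j) : v₀ j ≤ v₀ j + Pi.single (M := fun _ => ℝ) i c j := by
      have : (0 : Fin m ⊕ Fin n → ℝ) ≤ Pi.single i c := Pi.single_nonneg.2 hc0.le
      linarith [show (0 : ℝ) ≤ Pi.single (M := fun _ => ℝ) i c j from this j]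
    have h1 := hsep (fun j => v₀ j + Pi.single (M := fun _ => ℝ) i c j)
      ⟨k₀, B₀, C₀, hA₀, fun i => (hB₀ i).trans_le (hle _), fun j => (hC₀ j).trans_le (hle _)⟩
    simp only [mul_add, Finset.sum_add_distrib, Pi.single_apply, mul_ite, mul_zero,
      Finset.sum_ite_eq', Finset.mem_univ, if_true] at h1
    have h2 : w i * c = -(∑ i, w i * v₀ i - t * ∑ i, w i) := by
      rw [hc]
      have := hi.ne
      field_simp
    linarith
  have hS : 0 < ∑ i, w i := by
    refine (Finset.sum_nonneg fun i _ => hw0 i).lt_of_ne' fun h0 => ?_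
    have hz : ∀ i, w i = 0 := fun i =>
      (Finset.sum_eq_zero_iff_of_nonneg fun i _ => hw0 i).1 h0 i (Finset.mem_univ i)
    have := hsep _ ⟨k₀, B₀, C₀, hA₀, hB₀, hC₀⟩
    simp [hz] at this
  set S := ∑ i, w i with hSdef
  have hSsum : S = ∑ i, w (.inl i) + ∑ j, w (.inr j) := Fintype.sum_sum_type w
  -- Some weights may be 0, so all are raised by `δ`, at cost `δ T (m + n)`; making the profile
  -- strict costs another `δ S`.
  have hbound (δ : ℝ) (hδ : 0 < δ) : t * S < T * S + δ * (T * (m + n) + S) := by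
    obtain ⟨k, B, C, hA, hBC⟩ := h (fun i => w (.inl i) + δ) (fun j => w (.inr j) + δ)
      (fun i => by linarith [hw0 (.inl i)]) (fun j => by linarith [hw0 (.inr j)])
    have h1 := hsep (Sum.elim (fun i => ∑ l, B i l ^ 2 + δ) fun j => ∑ l, C l j ^ 2 + δ)
      ⟨k, B, C, hA, fun i => by simp [hδ], fun j => by simp [hδ]⟩
    have hB0 : 0 ≤ ∑ i, ∑ l, B i l ^ 2 :=
      Finset.sum_nonneg fun _ _ => Finset.sum_nonneg fun _ _ => sq_nonneg _
    have hC0 : 0 ≤ ∑ j, ∑ l, C l j ^ 2 :=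
      Finset.sum_nonneg fun _ _ => Finset.sum_nonneg fun _ _ => sq_nonneg _
    simp only [Fintype.sum_sum_type, Sum.elim_inl, Sum.elim_inr, mul_add, add_mul,
      Finset.sum_add_distrib, ← Finset.sum_mul, ← Finset.mul_sum, Finset.sum_const,
      Finset.card_univ, Fintype.card_fin, nsmul_eq_mul] at h1 hBC
    rw [hSsum] at h1 ⊢
    nlinarith [mul_nonneg hδ.le hB0, mul_nonneg hδ.le hC0]
  have hpos : 0 < T * (m + n) + S := by positivity
  -- This `δ` turns the bound into `t S < t S`.
  have h2 := hbound ((t - T) * S / (T * (m + n) + S))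
    (div_pos (mul_pos (sub_pos.2 hTt) hS) hpos)
  rw [div_mul_cancel₀ _ hpos.ne'] at h2
  linarith

/-! ### The logarithmic upper bound. -/

theorem gammaTwo_le_harmonic_mul_detlb {m n : ℕ} (A : Matrix (Fin m) (Fin n) ℝ) :
    gammaTwo A ≤ Real.exp 1 * harmonic A.rank * detlb A := by
  refine gammaTwo_le_of_forall_weighted A ?_ fun p q hp hq => ?_
  · have : 0 ≤ (harmonic A.rank : ℝ) := by
      exact_mod_cast Finset.sum_nonneg fun _ _ => by positivity
    exact mul_nonneg (mul_nonneg (Real.exp_pos 1).le this) (detlb_nonneg A)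
  · exact ⟨n, exists_factorization_weighted A hp hq⟩

/-- For `r ≥ 1` the constant in `1 + log r` is absorbed by `1 ≤ 2 log 2 ≤ 2 log (r + 1)`; at `r = 0`
both sides are 0. -/
theorem harmonic_le_three_mul_log (r : ℕ) : (harmonic r : ℝ) ≤ 3 * Real.log (r + 1) := by
  rcases Nat.eq_zero_or_pos r with rfl | hr
  · simp
  have hr1 : (1 : ℝ) ≤ r := by exact_mod_cast hr
  have h1 := harmonic_le_one_add_log r
  have h2 : Real.log r ≤ Real.log (r + 1) := Real.log_le_log (by linarith) (by linarith)
  have h3 : Real.log 2 ≤ Real.log (r + 1) := Real.log_le_log (by norm_num) (by linarith)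
  linarith [Real.log_two_gt_d9]

/-! ### Hereditary discrepancy: rounding and volume. -/

open MeasureTheory

theorem exists_disc_eq {m : ℕ} {ι : Type*} [Fintype ι] (A : Matrix (Fin m) ι ℝ) :
    ∃ x : ι → ℝ, (∀ j, x j = 1 ∨ x j = -1) ∧ disc A = ‖A.mulVec x‖ := by
  have hne : {d : ℝ | ∃ x : ι → ℝ, (∀ j, x j = 1 ∨ x j = -1) ∧ d = ‖A.mulVec x‖}.Nonempty :=
    ⟨_, fun _ => 1, fun _ => .inl rfl, rfl⟩
  refine hne.csInf_mem ?_
  have h : {x : ι → ℝ | ∀ j, x j ∈ ({1, -1} : Set ℝ)}.Finite :=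
    Set.Finite.pi' fun _ => Set.toFinite _
  refine (h.image fun x => ‖A.mulVec x‖).subset ?_
  rintro _ ⟨x, hx, rfl⟩
  exact ⟨x, hx, rfl⟩

theorem disc_le_herdisc {m n : ℕ} (A : Matrix (Fin m) (Fin n) ℝ) (J : Finset (Fin n)) :
    disc (A.submatrix id (fun j : J => (j : Fin n))) ≤ herdisc A := by
  refine le_csSup (Set.Finite.bddAbove ?_) ⟨J, rfl⟩
  refine (Set.finite_range fun J : Finset (Fin n) =>
    disc (A.submatrix id (fun j : J => (j : Fin n)))).subset ?_
  rintro _ ⟨J, rfl⟩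
  exact ⟨J, rfl⟩

/-- Every set of columns has a partial colouring of discrepancy at most `H`. -/
def HasPartialColorings {m n : ℕ} (A : Matrix (Fin m) (Fin n) ℝ) (H : ℝ) : Prop :=
  ∀ T : Finset (Fin n), ∃ ε : Fin n → ℤ, (∀ j ∈ T, ε j = 1 ∨ ε j = -1) ∧ (∀ j ∉ T, ε j = 0) ∧
    ‖A *ᵥ fun j => (ε j : ℝ)‖ ≤ H

theorem hasPartialColorings_herdisc {m n : ℕ} (A : Matrix (Fin m) (Fin n) ℝ) :
    HasPartialColorings A (herdisc A) := by
  intro T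
  obtain ⟨x, hx, hd⟩ := exists_disc_eq (A.submatrix id (fun j : T => (j : Fin n)))
  refine ⟨fun j => if h : j ∈ T then (if x ⟨j, h⟩ = 1 then 1 else -1) else 0, ?_, ?_, ?_⟩
  · intro j hj
    simp only [hj, dite_true]
    split_ifs <;> simp
  · intro j hj
    simp [hj]
  · refine le_trans (le_of_eq ?_) (disc_le_herdisc A T)
    rw [hd]
    congr 1
    ext i
    simp only [Matrix.mulVec, dotProduct, Matrix.submatrix_apply, id]
    rw [← Finset.sum_subset (Finset.subset_univ T) fun j _ hj => by simp [hj],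
      ← Finset.sum_coe_sort T]
    refine Finset.sum_congr rfl fun j _ => ?_
    simp only [j.2, dite_true]
    rcases hx j with h | h <;> rw [h] <;> norm_num

theorem HasPartialColorings.submatrix {m n k l : ℕ} {A : Matrix (Fin m) (Fin n) ℝ} {H : ℝ}
    (h : HasPartialColorings A H) (f : Fin k ↪ Fin m) (g : Fin l ↪ Fin n) :
    HasPartialColorings (A.submatrix f g) H := by
  intro T
  obtain ⟨ε, h1, h0, hε⟩ := h (T.map g)
  refine ⟨ε ∘ g, fun j hj => h1 _ (Finset.mem_map_of_mem g hj), fun j hj => h0 _ ?_, ?_⟩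
  · simpa using hj
  · refine (pi_norm_le_iff_of_nonneg ((norm_nonneg _).trans hε)).2 fun i => ?_
    refine le_trans (le_of_eq ?_) ((norm_le_pi_norm _ (f i)).trans hε)
    congr 1
    simp only [Matrix.mulVec, dotProduct, Matrix.submatrix_apply, Function.comp_apply]
    rw [← Finset.sum_subset (Finset.subset_univ (Finset.univ.map g)), Finset.sum_map]
    intro j _ hj
    rw [h0 j fun hj' => hj (Finset.map_subset_map.2 (Finset.subset_univ T) hj')]
    simp

/-- Rounding of dyadic vectors to integer vectors. -/
theorem HasPartialColorings.exists_rounding_dyadic {m n : ℕ} {A : Matrix (Fin m) (Fin n) ℝ}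
    {H : ℝ} (h : HasPartialColorings A H) (l : ℕ) (a : Fin n → ℤ) :
    ∃ x : Fin n → ℤ, ‖A *ᵥ fun j => (x j : ℝ) - a j / 2 ^ l‖ ≤ H * (1 - 1 / 2 ^ l) := by
  induction l generalizing a with
  | zero =>
    refine ⟨a, ?_⟩
    have : (fun j => (a j : ℝ) - a j / 2 ^ 0) = 0 := by ext; simp
    rw [this]
    simp
  | succ l ih =>
    -- Colouring the odd entries makes all of them even, which removes one binary digit at cost `H /
    -- 2 ^ (l + 1)`; the costs form a geometric series.
    obtain ⟨ε, h1, h0, hε⟩ := h {j | Odd (a j)}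
    have heven (j) : ∃ b, a j + ε j = 2 * b := by
      refine even_iff_two_dvd.1 ?_
      by_cases hj : Odd (a j)
      · rcases h1 j (by simpa using hj) with h | h <;> rw [h]
        · exact hj.add_odd odd_one
        · exact hj.add_odd (by decide)
      · rw [h0 j (by simpa using hj), add_zero]
        exact Int.not_odd_iff_even.1 hj
    choose b hb using heven
    obtain ⟨x, hx⟩ := ih b
    refine ⟨x, ?_⟩
    have hdecomp : (fun j => (x j : ℝ) - a j / 2 ^ (l + 1)) =
        (fun j => (x j : ℝ) - b j / 2 ^ l) + (1 / 2 ^ (l + 1) : ℝ) • fun j => (ε j : ℝ) := by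
      ext j
      have hb' : (a j : ℝ) + ε j = 2 * b j := by exact_mod_cast hb j
      simp only [Pi.add_apply, Pi.smul_apply, smul_eq_mul]
      rw [eq_sub_of_add_eq hb', pow_succ]
      field_simp
      ring
    rw [hdecomp, Matrix.mulVec_add, Matrix.mulVec_smul]
    refine (norm_add_le _ _).trans ?_
    rw [norm_smul, Real.norm_of_nonneg (by positivity)]
    have h2 := mul_le_mul_of_nonneg_left hε (show (0 : ℝ) ≤ 1 / 2 ^ (l + 1) by positivity)
    calc _ ≤ H * (1 - 1 / 2 ^ l) + 1 / 2 ^ (l + 1) * H := add_le_add hx h2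
      _ = _ := by
        rw [pow_succ]
        field_simp
        ring

/-- Truncate `y` to `l` binary digits, with `l` so large that `A` maps the truncation error to norm
at most `δ`. -/
theorem HasPartialColorings.exists_rounding {m n : ℕ} {A : Matrix (Fin m) (Fin n) ℝ}
    {H : ℝ} (h : HasPartialColorings A H) {δ : ℝ} (hδ : 0 < δ) (y : Fin n → ℝ) :
    ∃ x : Fin n → ℤ, ‖A *ᵥ ((fun j => (x j : ℝ)) - y)‖ ≤ H + δ := by
  have hH : 0 ≤ H := by
    obtain ⟨ε, -, -, hε⟩ := h ∅
    exact (norm_nonneg _).trans hε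
  set F := LinearMap.toContinuousLinearMap (Matrix.mulVecLin A) with hF
  obtain ⟨l, hl⟩ := exists_pow_lt_of_lt_one (show 0 < δ / (‖F‖ + 1) by positivity)
    (show (1 / 2 : ℝ) < 1 by norm_num)
  obtain ⟨x, hx⟩ := h.exists_rounding_dyadic l (fun j => ⌊2 ^ l * y j⌋)
  refine ⟨x, ?_⟩
  set e : Fin n → ℝ := fun j => (⌊2 ^ l * y j⌋ : ℝ) / 2 ^ l - y j with he
  have hdecomp : (fun j => (x j : ℝ)) - y =
      (fun j => (x j : ℝ) - (⌊2 ^ l * y j⌋ : ℝ) / 2 ^ l) + e := by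
    ext j
    simp [he]
  have henorm : ‖e‖ ≤ (1 / 2) ^ l := by
    refine (pi_norm_le_iff_of_nonneg (by positivity)).2 fun j => ?_
    have h2 : (0 : ℝ) < 2 ^ l := by positivity
    have h3 : e j = (⌊2 ^ l * y j⌋ - 2 ^ l * y j) * (1 / 2) ^ l := by
      simp only [he, one_div, inv_pow]
      field_simp
    rw [h3, norm_mul, Real.norm_of_nonneg (show (0 : ℝ) ≤ (1 / 2) ^ l by positivity)]
    refine mul_le_of_le_one_left (by positivity) ?_
    rw [Real.norm_eq_abs, abs_le]
    constructor
    · linarith [Int.lt_floor_add_one (2 ^ l * y j)]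
    · linarith [Int.floor_le (2 ^ l * y j)]
  rw [hdecomp, Matrix.mulVec_add]
  refine (norm_add_le _ _).trans (add_le_add (hx.trans ?_) ?_)
  · have : (0 : ℝ) ≤ 1 / 2 ^ l := by positivity
    nlinarith
  · calc ‖A *ᵥ e‖ = ‖F e‖ := rfl
      _ ≤ ‖F‖ * ‖e‖ := F.le_opNorm e
      _ ≤ (‖F‖ + 1) * (δ / (‖F‖ + 1)) :=
        mul_le_mul (by linarith) (henorm.trans hl.le) (norm_nonneg _) (by positivity)
      _ = δ := mul_div_cancel₀ _ (by positivity)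

/-- A measurable set whose integer translates cover the space has volume at least one. -/
theorem one_le_volume_of_forall_exists_sub_mem {k : ℕ} {P : Set (Fin k → ℝ)}
    (hP : MeasurableSet P) (h : ∀ y : Fin k → ℝ, ∃ x : Fin k → ℤ, (fun j => (x j : ℝ)) - y ∈ P) :
    1 ≤ volume P := by
  set Q : Set (Fin k → ℝ) := Set.univ.pi fun _ => Set.Ico 0 1 with hQ
  have hQm : MeasurableSet Q := MeasurableSet.univ_pi fun _ => measurableSet_Ico
  have hQv : volume Q = 1 := by simp [hQ, Real.volume_pi_Ico]
  set c : (Fin k → ℤ) → (Fin k → ℝ) := fun x j => (x j : ℝ) with hc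
  have hcm (z) : Measurable fun v : Fin k → ℝ => c z - v := by fun_prop
  have hcover : Q ⊆ ⋃ z, Q ∩ (fun v => c z - v) ⁻¹' P := fun y hy => by
    obtain ⟨x, hx⟩ := h y
    exact Set.mem_iUnion.2 ⟨x, hy, hx⟩
  -- Two integer points in `v + [0, 1) ^ k` coincide. The reflection `v ↦ c z - v` carries the
  -- pieces covering the cube to these disjoint pieces of `P`.
  have hdisj : Pairwise (Function.onFun Disjoint fun z => (fun v => c z - v) ⁻¹' Q ∩ P) := by
    intro z z' hne
    refine Set.disjoint_left.2 fun v hv hv' => hne (funext fun j => ?_)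
    have h1 := hv.1 j (Set.mem_univ j)
    have h2 := hv'.1 j (Set.mem_univ j)
    simp only [hc, Pi.sub_apply, Set.mem_Ico] at h1 h2
    have h3 : (z j : ℝ) < z' j + 1 := by linarith
    have h4 : (z' j : ℝ) < z j + 1 := by linarith
    norm_cast at h3 h4
    omega
  have htrans (z) : volume (Q ∩ (fun v => c z - v) ⁻¹' P) =
      volume ((fun v => c z - v) ⁻¹' Q ∩ P) := by
    rw [← (Measure.measurePreserving_sub_left volume (c z)).measure_preimage
      ((hcm z hQm).inter hP).nullMeasurableSet]
    congr 1
    ext v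
    simp
  calc 1 = volume Q := hQv.symm
    _ ≤ volume (⋃ z, Q ∩ (fun v => c z - v) ⁻¹' P) := measure_mono hcover
    _ ≤ ∑' z, volume (Q ∩ (fun v => c z - v) ⁻¹' P) := measure_iUnion_le _
    _ = ∑' z, volume ((fun v => c z - v) ⁻¹' Q ∩ P) := tsum_congr htrans
    _ = volume (⋃ z, (fun v => c z - v) ⁻¹' Q ∩ P) :=
      (measure_iUnion hdisj fun z => (hcm z hQm).inter hP).symm
    _ ≤ volume P := measure_mono (Set.iUnion_subset fun z => Set.inter_subset_right)

theorem HasPartialColorings.abs_det_le {k : ℕ} {B : Matrix (Fin k) (Fin k) ℝ} {H : ℝ}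
    (h : HasPartialColorings B H) : |B.det| ≤ (2 * H) ^ k := by
  have hH : 0 ≤ H := by
    obtain ⟨ε, -, -, hε⟩ := h ∅
    exact (norm_nonneg _).trans hε
  by_cases hdet : B.det = 0
  · rw [hdet, abs_zero]
    positivity
  -- The preimage of the cube of side `2 (H + δ)` has volume `(2 (H + δ)) ^ k / |det B|`, and its
  -- integer translates cover space.
  have key (δ : ℝ) (hδ : 0 < δ) : |B.det| ≤ (2 * (H + δ)) ^ k := by
    have hm : MeasurableSet (Matrix.toLin' B ⁻¹' Metric.closedBall 0 (H + δ)) :=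
      (Metric.isClosed_closedBall.preimage
        (LinearMap.continuous_of_finiteDimensional _)).measurableSet
    have h1 := one_le_volume_of_forall_exists_sub_mem hm fun y => by
      obtain ⟨x, hx⟩ := h.exists_rounding hδ y
      exact ⟨x, by simpa using hx⟩
    rw [Measure.addHaar_preimage_linearMap _ (by rwa [LinearMap.det_toLin']),
      Real.volume_pi_closedBall _ (by positivity), LinearMap.det_toLin', Fintype.card_fin,
      ← ENNReal.ofReal_mul (abs_nonneg _), ENNReal.one_le_ofReal, abs_inv] at h1
    rwa [← div_eq_inv_mul, one_le_div (abs_pos.2 hdet)] at h1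
  have hlim : Filter.Tendsto (fun δ : ℝ => (2 * (H + δ)) ^ k) (nhdsWithin 0 (Set.Ioi 0))
      (nhds ((2 * (H + 0)) ^ k)) :=
    (Continuous.tendsto (by fun_prop) 0).mono_left nhdsWithin_le_nhds
  rw [add_zero] at hlim
  exact ge_of_tendsto hlim (by filter_upwards [self_mem_nhdsWithin] with δ hδ using key δ hδ)

theorem herdisc_nonneg {m n : ℕ} (A : Matrix (Fin m) (Fin n) ℝ) : 0 ≤ herdisc A := by
  obtain ⟨ε, -, -, hε⟩ := hasPartialColorings_herdisc A ∅
  exact (norm_nonneg _).trans hε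

/-- The determinant lower bound of Lovász, Spencer and Vesztergombi. -/
theorem detlb_le_two_mul_herdisc {m n : ℕ} (A : Matrix (Fin m) (Fin n) ℝ) :
    detlb A ≤ 2 * herdisc A := by
  have hH := herdisc_nonneg A
  refine Real.sSup_le ?_ (by positivity)
  rintro _ ⟨k, hk, f, g, rfl⟩
  have h := ((hasPartialColorings_herdisc A).submatrix f.toEmbedding g.toEmbedding).abs_det_le
  calc _ ≤ ((2 * herdisc A) ^ k) ^ (1 / (k : ℝ)) :=
        Real.rpow_le_rpow (abs_nonneg _) h (by positivity)
    _ = _ := by rw [one_div, Real.pow_rpow_inv_natCast (by positivity) (by omega)]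

theorem gammaTwo_le_log_mul_detlb {m n : ℕ} (A : Matrix (Fin m) (Fin n) ℝ) :
    gammaTwo A ≤ 3 * Real.exp 1 * Real.log (A.rank + 1) * detlb A := by
  refine (gammaTwo_le_harmonic_mul_detlb A).trans
    (mul_le_mul_of_nonneg_right ?_ (detlb_nonneg A))
  calc _ ≤ Real.exp 1 * (3 * Real.log (A.rank + 1)) :=
        mul_le_mul_of_nonneg_left (harmonic_le_three_mul_log _) (Real.exp_pos 1).le
    _ = _ := by ring

theorem gammaTwo_le_log_mul_herdisc {m n : ℕ} (A : Matrix (Fin m) (Fin n) ℝ) {k : ℕ}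
    (hk : A.rank ≤ k) : gammaTwo A ≤ 6 * Real.exp 1 * Real.log (k + 1) * herdisc A := by
  have hkR : (A.rank : ℝ) ≤ k := by exact_mod_cast hk
  have hlog : Real.log (A.rank + 1) ≤ Real.log (k + 1) :=
    Real.log_le_log (by positivity) (by linarith)
  have h0 : 0 ≤ Real.log (k + 1) := Real.log_nonneg (by linarith [k.cast_nonneg (α := ℝ)])
  calc _ ≤ 3 * Real.exp 1 * Real.log (A.rank + 1) * detlb A := gammaTwo_le_log_mul_detlb A
    _ ≤ 3 * Real.exp 1 * Real.log (k + 1) * (2 * herdisc A) :=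
      mul_le_mul (mul_le_mul_of_nonneg_left hlog (by positivity)) (detlb_le_two_mul_herdisc A)
        (detlb_nonneg A) (by positivity)
    _ = _ := by ring

end FactorizationNorm

theorem theorem3p1 :
    ∃ C : ℝ, 0 < C ∧ ∀ (m n : ℕ) (A : Matrix (Fin m) (Fin n) ℝ),
      FactorizationNorm.detlb A ≤ FactorizationNorm.gammaTwo A ∧
      FactorizationNorm.gammaTwo A ≤
        C * Real.log ((A.rank : ℝ) + 1) * FactorizationNorm.detlb A ∧
      FactorizationNorm.detlb A / 2 ≤ FactorizationNorm.herdisc A ∧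
      FactorizationNorm.gammaTwo A ≤
        C * Real.log (((min m n : ℕ) : ℝ) + 1) * FactorizationNorm.herdisc A ∧
      FactorizationNorm.gammaTwo A ≤
        C * Real.log ((m : ℝ) + 1) * FactorizationNorm.herdisc A := by
  refine ⟨6 * Real.exp 1, by positivity, fun m n A =>
    ⟨FactorizationNorm.detlb_le_gammaTwo A, ?_, ?_, ?_, ?_⟩⟩
  · refine (FactorizationNorm.gammaTwo_le_log_mul_detlb A).trans
      (mul_le_mul_of_nonneg_right ?_ (FactorizationNorm.detlb_nonneg A))
    have h0 : 0 ≤ Real.log (A.rank + 1) :=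
      Real.log_nonneg (by linarith [A.rank.cast_nonneg (α := ℝ)])
    nlinarith [mul_nonneg (Real.exp_pos 1).le h0]
  · linarith [FactorizationNorm.detlb_le_two_mul_herdisc A]
  · exact FactorizationNorm.gammaTwo_le_log_mul_herdisc A
      (le_min (by simpa using A.rank_le_height) (by simpa using A.rank_le_width))
  · exact FactorizationNorm.gammaTwo_le_log_mul_herdisc A (by simpa using A.rank_le_height)
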